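/- Let $n\ge 1$ and let $\pi=(d_0\ge d_1\ge\cdots\ge d_{n-1})$ be a nonincreasing sequence of nonnegative integers that is the degree sequence of some tree. Let $\mathcal T_\pi$ be the set of all trees with degree sequence $\pi$, and for a tree $T$ let $\varphi(T)$ be the number of nonempty subtrees of $T$ (subgraphs of $T$ that are trees with at least one vertex). Let $T^*_\pi$ be the breadth-first (greedy) tree of $\pi$, constructed as follows: its vertices are $v_0,\dots,v_{n-1}$, numbered level by level and from left to right; the root $v_0$ has the $d_0$ children $v_1,\dots,v_{d_0}$; then, for $i=1,2,\dots,n-1$ in turn, $v_i$ receives as its children the next $d_i-1$ vertices in the numbering that do not yet have a parent. Then $T^*_\pi\in\mathcal T_\pi$, and every $T\in\mathcal T_\pi$ satisfies $$\varphi(T)\le\varphi(T^*_\pi),$$ with equality if and only if $T$ is isomorphic to $T^*_\pi$. That is, $T^*_\pi$ is, up to isomorphism, the unique tree with the largest number of nonempty subtrees in $\mathcal T_\pi$. -/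

import Mathlib

namespace GreedyTree

open Classical in
/-- `π` is the degree sequence of `G`: the vertices of `G` can be listed, each exactly once, so that
the `i`-th vertex has degree `π i`. -/
def HasDegreeSequence {V : Type*} [Fintype V] (G : SimpleGraph V) {n : ℕ} (π : Fin n → ℕ) : Prop :=
  ∃ e : Fin n ≃ V, ∀ i, G.degree (e i) = π i

/-- The number of (nonempty) subtrees of `G`: the subgraphs of `G` that are trees. (In Mathlib a
tree has at least one vertex.) -/
noncomputable def numSubtrees {V : Type*} (G : SimpleGraph V) : ℕ :=
  {H : G.Subgraph | H.coe.IsTree}.ncard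

/-- The number of children of the vertex `k` in the breadth-first construction from `π`: the root
`0` has `π 0` children, any other vertex has one neighbour (its parent) that is not a child. -/
def numChildren {n : ℕ} (π : Fin n → ℕ) (k : Fin n) : ℕ :=
  if k.val = 0 then π k else π k - 1

/-- In breadth-first order, the label of the first child of vertex `i`: the root has label `0`, and
then come all the children of the vertices `k < i`. -/
def firstChild {n : ℕ} (π : Fin n → ℕ) (i : ℕ) : ℕ :=
  1 + ∑ k : Fin n with k.val < i, numChildren π k

/-- The breadth-first (greedy) tree of `π`. Its vertices are labelled `0, …, n - 1`, level by level
and from left to right; vertex `0` is the root, and the vertices in turn receive as their children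
the next `numChildren π i` vertices that have no parent yet. So the children of `i` are
the vertices `j` with `firstChild π i ≤ j < firstChild π (i + 1)`. -/
def greedyTree {n : ℕ} (π : Fin n → ℕ) : SimpleGraph (Fin n) :=
  SimpleGraph.fromRel fun i j => firstChild π i.val ≤ j.val ∧ j.val < firstChild π (i.val + 1)

end GreedyTree

/-! In a forest a subtree is determined by its vertex set, so subtrees can be counted as connected
vertex sets. Let f(v) be the number of those containing v. Take a tree T with the given degrees and
the largest count; one exists by finiteness. Three facts shape T. Along a path a, b, c of a finite
forest, f(b) ≤ f(a) forces f(c) < f(b) (`connCount_lt_of_path`), so f never increases on moving away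
from a root where it is maximal. Exchanging branches rooted at u and v that hang from distinct
vertices x and y keeps all degrees, and optimality then gives f(x) < f(y) iff f(u) < f(v)
(`IsOptimal.connCount_lt_iff`). Moving surplus branches from one vertex to another swaps their
degrees, and optimality then makes the degree monotone in f (`IsOptimal.ncard_neighborSet_le`).

Number the vertices of T breadth first, siblings by decreasing f. The exchange fact carries the
comparison of f from parents to children, so f, and with it the degree, is nonincreasing in this
numbering. Hence the i-th vertex has degree π i, and breadth-first order with these degrees
determines the tree (`iso_greedyTree`). So every optimal tree is the greedy tree. Since an optimal
tree exists, this yields that the greedy tree is a tree, that it has the right degrees, that it is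
optimal, and that it is unique. -/

namespace GreedyTree

open SimpleGraph

/-! ### Connected vertex sets and their counts -/

variable {V : Type*}

/-- `S` is nonempty and connected in `G`: no nonempty proper part of `S` is closed under adjacency
in `S`. -/
def IsConn (G : SimpleGraph V) (S : Set V) : Prop :=
  S.Nonempty ∧ ∀ A : Set V, (S ∩ A).Nonempty → (∀ a ∈ S, a ∈ A → ∀ b ∈ S, G.Adj a b → b ∈ A) → S ⊆ A

/-- The number of connected vertex sets of `G` that contain `R`. -/
noncomputable def connCount (G : SimpleGraph V) (R : Set V) : ℕ :=
  {S : Set V | IsConn G S ∧ R ⊆ S}.ncard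

theorem IsConn.mono {F G : SimpleGraph V} (h : F ≤ G) {S : Set V} (hS : IsConn F S) : IsConn G S :=
  ⟨hS.1, fun A hA hc => hS.2 A hA fun a ha haA b hb hab => hc a ha haA b hb (h hab)⟩

theorem IsConn.reachable {F : SimpleGraph V} {S : Set V} (hS : IsConn F S) {a b : V}
    (ha : a ∈ S) (hb : b ∈ S) : F.Reachable a b :=
  hS.2 {z | F.Reachable a z} ⟨a, ha, .refl a⟩
    (fun _ _ hz _ _ hzw => Reachable.trans hz hzw.reachable) hb

theorem isConn_singleton (G : SimpleGraph V) (v : V) : IsConn G {v} := by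
  refine ⟨⟨v, rfl⟩, ?_⟩
  rintro A ⟨a, rfl, ha⟩ _
  simpa using ha

theorem eq_or_eq_of_edge_adj {x u a b : V} (h : (edge x u).Adj a b) : (a = x ∧ b = u) ∨ (a = u ∧ b = x) := by
  rw [edge_adj] at h
  tauto

theorem isConn_sup_edge_union {F : SimpleGraph V} {x u : V} (hxu : x ≠ u) {S₁ S₂ : Set V}
    (h₁ : IsConn F S₁) (h₂ : IsConn F S₂) (hx : x ∈ S₁) (hu : u ∈ S₂) :
    IsConn (F ⊔ edge x u) (S₁ ∪ S₂) := by
  have hadj : (F ⊔ edge x u).Adj x u := by simp [edge_adj, hxu]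
  refine ⟨⟨x, Or.inl hx⟩, fun A hA hc => ?_⟩
  have k₁ : (S₁ ∩ A).Nonempty → S₁ ⊆ A := fun h => h₁.2 A h fun a ha haA b hb hab =>
    hc a (Or.inl ha) haA b (Or.inl hb) (Or.inl hab)
  have k₂ : (S₂ ∩ A).Nonempty → S₂ ⊆ A := fun h => h₂.2 A h fun a ha haA b hb hab =>
    hc a (Or.inr ha) haA b (Or.inr hb) (Or.inl hab)
  obtain ⟨a, ha | ha, haA⟩ := hA
  · have h := k₁ ⟨a, ha, haA⟩
    exact Set.union_subset h
      (k₂ ⟨u, hu, hc x (Or.inl hx) (h hx) u (Or.inr hu) hadj⟩)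
  · have h := k₂ ⟨a, ha, haA⟩
    exact Set.union_subset
      (k₁ ⟨x, hx, hc u (Or.inr hu) (h hu) x (Or.inl hx) hadj.symm⟩) h

/-- A part of a connected set `S` of `F ⊔ edge x u` that contains `x` but not `u` and that is closed
under adjacency of `F` in `S` is connected in `F`. -/
theorem isConn_inter_of_sup_edge {F : SimpleGraph V} {x u : V} {S A : Set V}
    (hS : IsConn (F ⊔ edge x u) S) (hx : x ∈ S ∩ A) (hu : u ∈ S \ A)
    (hA : ∀ a ∈ S, a ∈ A → ∀ b ∈ S, F.Adj a b → b ∈ A) : IsConn F (S ∩ A) := by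
  -- The new edge meets `A` only at `x`, so a set `C` inside `S ∩ A` that misses `x` and is closed
  -- for `F` is closed for the larger graph too, against the connectedness of `S`.
  have key : ∀ C : Set V, x ∉ C → C ⊆ S ∩ A → C.Nonempty →
      (∀ a ∈ C, ∀ b ∈ S ∩ A, F.Adj a b → b ∈ C) → False := by
    intro C hxC hCS ⟨c, hc⟩ hcl
    refine hxC (hS.2 C ⟨c, (hCS hc).1, hc⟩ ?_ hx.1)
    rintro a ha haC b hb (hab | hab)
    · exact hcl a haC b ⟨hb, hA a ha (hCS haC).2 b hb hab⟩ hab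
    · rcases eq_or_eq_of_edge_adj hab with ⟨rfl, rfl⟩ | ⟨rfl, rfl⟩
      · exact absurd haC hxC
      · exact absurd (hCS haC).2 hu.2
  refine ⟨⟨x, hx⟩, fun B hB hcl => ?_⟩
  by_cases hxB : x ∈ B
  · intro z hz
    by_contra hzB
    refine key ((S ∩ A) \ B) (fun h => h.2 hxB) Set.sdiff_subset ⟨z, hz, hzB⟩ ?_
    intro a ha b hb hab
    exact ⟨hb, fun hbB => ha.2 (hcl b hb hbB a ha.1 hab.symm)⟩
  · refine (key ((S ∩ A) ∩ B) (fun h => hxB h.2) Set.inter_subset_left hB ?_).elim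
    intro a ha b hb hab
    exact ⟨hb, hcl a ha.1 ha.2 b hb hab⟩

/-- A part `A` witnessing disconnection in `F` is left only by the new edge, so `S ∩ A` and `S \ A`
are the two pieces. -/
theorem exists_isConn_union_of_sup_edge {F : SimpleGraph V} {x u : V} {S : Set V}
    (hS : IsConn (F ⊔ edge x u) S) (hF : ¬ IsConn F S) :
    ∃ S₁ S₂, IsConn F S₁ ∧ IsConn F S₂ ∧ x ∈ S₁ ∧ u ∈ S₂ ∧ S = S₁ ∪ S₂ := by
  obtain ⟨A, hA, hcl, hSA⟩ : ∃ A : Set V, (S ∩ A).Nonempty ∧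
      (∀ a ∈ S, a ∈ A → ∀ b ∈ S, F.Adj a b → b ∈ A) ∧ ¬ S ⊆ A := by
    by_contra! h
    exact hF ⟨hS.1, fun A hA hc => h A hA hc⟩
  have hcl' : ∀ a ∈ S, a ∈ Aᶜ → ∀ b ∈ S, F.Adj a b → b ∈ Aᶜ :=
    fun a ha haA b hb hab hbA => haA (hcl b hb hbA a ha hab.symm)
  have hedge : ¬ ∀ a ∈ S, a ∈ A → ∀ b ∈ S, (F ⊔ edge x u).Adj a b → b ∈ A :=
    fun h => hSA (hS.2 A hA h)
  push Not at hedge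
  obtain ⟨a, ha, haA, b, hb, hab, hbA⟩ := hedge
  have hS' : IsConn (F ⊔ edge u x) S := by rwa [edge_comm]
  rcases hab with hab | hab
  · exact absurd (hcl a ha haA b hb hab) hbA
  · rcases eq_or_eq_of_edge_adj hab with ⟨rfl, rfl⟩ | ⟨rfl, rfl⟩
    · exact ⟨S ∩ A, S ∩ Aᶜ, isConn_inter_of_sup_edge hS ⟨ha, haA⟩ ⟨hb, hbA⟩ hcl,
        isConn_inter_of_sup_edge hS' ⟨hb, hbA⟩ ⟨ha, fun h => h haA⟩ hcl', ⟨ha, haA⟩, ⟨hb, hbA⟩,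
        (Set.inter_union_compl S A).symm⟩
    · exact ⟨S ∩ Aᶜ, S ∩ A, isConn_inter_of_sup_edge hS ⟨hb, hbA⟩ ⟨ha, fun h => h haA⟩ hcl',
        isConn_inter_of_sup_edge hS' ⟨ha, haA⟩ ⟨hb, hbA⟩ hcl, ⟨hb, hbA⟩, ⟨ha, haA⟩,
        by rw [Set.union_comm, Set.inter_union_compl]⟩

/-- A connected set either is already connected in `F` or splits uniquely into its parts in the
components of `x` and `u`. `R` must then fall in the first part and `Q` in the second. -/
theorem connCount_sup_edge_union [Finite V] {F : SimpleGraph V} {x u : V}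
    (hxu : ¬ F.Reachable x u) {R Q : Set V} (hR : ∀ r ∈ R, ¬ F.Reachable u r)
    (hQ : ∀ r ∈ Q, ¬ F.Reachable x r) :
    connCount (F ⊔ edge x u) (R ∪ Q) =
      connCount F (R ∪ Q) + connCount F (insert x R) * connCount F (insert u Q) := by
  have hne : x ≠ u := by rintro rfl; exact hxu (.refl _)
  have hset : {S : Set V | IsConn (F ⊔ edge x u) S ∧ R ∪ Q ⊆ S} =
      {S : Set V | IsConn F S ∧ R ∪ Q ⊆ S} ∪ (fun q : Set V × Set V => q.1 ∪ q.2) ''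
        ({S : Set V | IsConn F S ∧ insert x R ⊆ S} ×ˢ {S : Set V | IsConn F S ∧ insert u Q ⊆ S}) := by
    ext S
    constructor
    · rintro ⟨hS, hRS⟩
      by_cases hF : IsConn F S
      · exact Or.inl ⟨hF, hRS⟩
      · obtain ⟨S₁, S₂, h₁, h₂, hx, hu, rfl⟩ := exists_isConn_union_of_sup_edge hS hF
        refine Or.inr ⟨(S₁, S₂), ⟨⟨h₁, Set.insert_subset hx fun r hr => ?_⟩,
          h₂, Set.insert_subset hu fun r hr => ?_⟩, rfl⟩
        · exact (hRS (Or.inl hr)).resolve_right fun h => hR r hr (h₂.reachable hu h)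
        · exact (hRS (Or.inr hr)).resolve_left fun h => hQ r hr (h₁.reachable hx h)
    · rintro (⟨hS, hRS⟩ | ⟨⟨S₁, S₂⟩, ⟨⟨h₁, hR₁⟩, h₂, hu⟩, rfl⟩)
      · exact ⟨hS.mono le_sup_left, hRS⟩
      · rw [Set.insert_subset_iff] at hR₁ hu
        exact ⟨isConn_sup_edge_union hne h₁ h₂ hR₁.1 hu.1, Set.union_subset_union hR₁.2 hu.2⟩
  unfold connCount
  rw [hset, Set.ncard_union_eq _ (Set.toFinite _) (Set.toFinite _), Set.InjOn.ncard_image,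
    Set.ncard_prod]
  · rintro ⟨S₁, S₂⟩ ⟨⟨h₁, hx⟩, h₂, hu⟩ ⟨T₁, T₂⟩ ⟨⟨k₁, kx⟩, k₂, ku⟩ heq
    simp only [Set.insert_subset_iff] at heq hx hu kx ku h₁ h₂ k₁ k₂
    have sep : ∀ {A B : Set V}, IsConn F A → IsConn F B → x ∈ A → u ∈ B → ∀ z ∈ A, z ∉ B :=
      fun hA hB hxA huB z hzA hzB => hxu ((hA.reachable hxA hzA).trans (hB.reachable hzB huB))
    have e₁ : S₁ = T₁ := by
      ext z
      constructor
      · intro hz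
        exact ((heq ▸ Or.inl hz : z ∈ T₁ ∪ T₂)).resolve_right (sep h₁ k₂ hx.1 ku.1 z hz)
      · intro hz
        exact ((heq.symm ▸ Or.inl hz : z ∈ S₁ ∪ S₂)).resolve_right (sep k₁ h₂ kx.1 hu.1 z hz)
    have e₂ : S₂ = T₂ := by
      ext z
      constructor
      · intro hz
        exact ((heq ▸ Or.inr hz : z ∈ T₁ ∪ T₂)).resolve_left
          fun h => sep k₁ h₂ kx.1 hu.1 z h hz
      · intro hz
        exact ((heq.symm ▸ Or.inr hz : z ∈ S₁ ∪ S₂)).resolve_left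
          fun h => sep h₁ k₂ hx.1 ku.1 z h hz
    rw [e₁, e₂]
  · rw [Set.disjoint_left]
    rintro S ⟨hS, -⟩ ⟨⟨S₁, S₂⟩, ⟨⟨h₁, hR₁⟩, h₂, hu⟩, rfl⟩
    exact hxu (hS.reachable (Or.inl (hR₁ (Set.mem_insert _ _))) (Or.inr (hu (Set.mem_insert _ _))))

theorem connCount_sup_edge [Finite V] {F : SimpleGraph V} {x u : V} (hxu : ¬ F.Reachable x u)
    {R : Set V} (hR : ∀ r ∈ R, ¬ F.Reachable u r) :
    connCount (F ⊔ edge x u) R =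
      connCount F R + connCount F (insert x R) * connCount F {u} := by
  simpa using connCount_sup_edge_union hxu hR (Q := ∅) (by simp)

theorem connCount_eq_zero {F : SimpleGraph V} {a b : V} {R : Set V} (ha : a ∈ R) (hb : b ∈ R)
    (h : ¬ F.Reachable a b) : connCount F R = 0 := by
  have : {S : Set V | IsConn F S ∧ R ⊆ S} = ∅ := by
    ext S
    simp only [Set.mem_ofPred_eq, Set.mem_empty_iff_false, iff_false, not_and]
    exact fun hS hR => h (hS.reachable (hR ha) (hR hb))
  rw [connCount, this, Set.ncard_empty]

theorem connCount_singleton_pos [Finite V] (F : SimpleGraph V) (v : V) :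
    0 < connCount F {v} :=
  (Set.ncard_pos (Set.toFinite _)).2 ⟨{v}, isConn_singleton F v, subset_rfl⟩

theorem connCount_pair_lt [Finite V] (F : SimpleGraph V) {u v : V} (h : u ≠ v) :
    connCount F {u, v} < connCount F {v} := by
  refine Set.ncard_lt_ncard ⟨fun S hS => ⟨hS.1, (Set.subset_insert _ _).trans hS.2⟩, fun hsub => ?_⟩
    (Set.toFinite _)
  have := (hsub ⟨isConn_singleton F v, subset_rfl⟩ : _ ∧ _).2 (Set.mem_insert u _)
  exact h this

/-! ### Subtrees of a forest as connected vertex sets -/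

theorem mem_of_reachable_of_closed {G : SimpleGraph V} {w z : V} {C : Set V} (hw : w ∈ C)
    (hC : ∀ a ∈ C, ∀ b, G.Adj a b → b ∈ C) (h : G.Reachable w z) : z ∈ C := by
  obtain ⟨p⟩ := h
  induction p with
  | nil => exact hw
  | cons hab _ ih => exact ih (hC _ hw _ hab)

/-- If the edge were missing from `H`, a path in `H` would join its ends without it, yet every edge
of a forest is a bridge. -/
theorem subgraph_adj_of_connected {T : SimpleGraph V} (hT : T.IsAcyclic) {H : T.Subgraph}
    (hH : H.coe.Connected) {a b : V} (ha : a ∈ H.verts) (hb : b ∈ H.verts) (hab : T.Adj a b) :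
    H.Adj a b := by
  by_contra hn
  have hbr := isAcyclic_iff_forall_adj_isBridge.1 hT hab
  rw [isBridge_iff] at hbr
  refine hbr ?_
  obtain ⟨p⟩ := hH.preconnected ⟨a, ha⟩ ⟨b, hb⟩
  let φ : H.coe →g T.deleteEdges {s(a, b)} :=
    { toFun := Subtype.val
      map_rel' := by
        intro x y hxy
        rw [deleteEdges_adj]
        refine ⟨H.adj_sub hxy, fun hmem => hn ?_⟩
        rw [Subgraph.coe_adj] at hxy
        rw [Set.mem_singleton_iff, Sym2.eq_iff] at hmem
        rcases hmem with ⟨h₁, h₂⟩ | ⟨h₁, h₂⟩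
        · rwa [h₁, h₂] at hxy
        · rw [h₁, h₂] at hxy; exact hxy.symm }
  exact ⟨p.map φ⟩

theorem isConn_verts_of_connected {T : SimpleGraph V} {H : T.Subgraph} (hH : H.coe.Connected) :
    IsConn T H.verts := by
  obtain ⟨⟨v, hv⟩⟩ := hH.nonempty
  refine ⟨⟨v, hv⟩, ?_⟩
  rintro A ⟨a, ha, haA⟩ hc b hb
  exact mem_of_reachable_of_closed (G := H.coe) (w := ⟨a, ha⟩) (z := ⟨b, hb⟩)
    (C := {z | (z : V) ∈ A}) haA
    (fun x hx y hxy => hc x x.2 hx y y.2 (H.adj_sub hxy)) (hH.preconnected _ _)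

theorem connected_induce_of_isConn {T : SimpleGraph V} {S : Set V} (hS : IsConn T S) :
    ((⊤ : T.Subgraph).induce S).coe.Connected := by
  obtain ⟨⟨v, hv⟩, hc⟩ := hS
  have hv' : v ∈ ((⊤ : T.Subgraph).induce S).verts := hv
  have : Nonempty ((⊤ : T.Subgraph).induce S).verts := ⟨⟨v, hv'⟩⟩
  have key : ∀ (a b : ((⊤ : T.Subgraph).induce S).verts),
      ((⊤ : T.Subgraph).induce S).coe.Reachable a b := by
    rintro ⟨a, ha⟩ ⟨b, hb⟩
    have := hc {z | ∃ h : z ∈ S, ((⊤ : T.Subgraph).induce S).coe.Reachable ⟨a, ha⟩ ⟨z, h⟩}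
      ⟨a, ha, ha, .refl _⟩ ?_ hb
    · exact this.2
    · rintro x hx ⟨_, hxr⟩ y hy hxy
      refine ⟨hy, hxr.trans (Adj.reachable ?_)⟩
      rw [Subgraph.coe_adj]
      exact ⟨hx, hy, hxy⟩
  exact ⟨key⟩

/-- In a forest, the subtrees correspond to the connected vertex sets. -/
theorem numSubtrees_eq_connCount {T : SimpleGraph V} (hT : T.IsAcyclic) :
    numSubtrees T = connCount T ∅ := by
  refine Set.ncard_congr (fun H _ => H.verts) ?_ ?_ ?_
  · intro H hH
    exact ⟨isConn_verts_of_connected hH.connected, Set.empty_subset _⟩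
  · intro H K hH hK hHK
    replace hHK : H.verts = K.verts := hHK
    refine Subgraph.ext hHK ?_
    ext a b
    constructor
    · intro h
      exact subgraph_adj_of_connected hT hK.connected (hHK ▸ h.fst_mem) (hHK ▸ h.snd_mem) h.adj_sub
    · intro h
      exact subgraph_adj_of_connected hT hH.connected (hHK ▸ h.fst_mem) (hHK ▸ h.snd_mem) h.adj_sub
  · rintro S ⟨hS, -⟩
    exact ⟨(⊤ : T.Subgraph).induce S, ⟨connected_induce_of_isConn hS, hT.subgraph _⟩, rfl⟩

/-! ### Attaching several branches at one vertex -/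

/-- The vertices of `L` lie in distinct components of `F`, none of which contains `v`. -/
structure Separated (F : SimpleGraph V) (v : V) (L : Finset V) : Prop where
  center : ∀ w ∈ L, ¬ F.Reachable v w
  pairwise : ∀ w ∈ L, ∀ w' ∈ L, w ≠ w' → ¬ F.Reachable w w'

/-- `F` with edges added from `v` to all vertices of `L`. -/
def addStar (F : SimpleGraph V) (v : V) (L : Finset V) : SimpleGraph V :=
  F ⊔ L.sup (edge v)

theorem addStar_adj {F : SimpleGraph V} {v : V} {L : Finset V} {a b : V} :
    (addStar F v L).Adj a b ↔ F.Adj a b ∨ ∃ w ∈ L, (edge v w).Adj a b := by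
  simp [addStar, Finset.sup_eq_iSup, iSup_adj]

theorem addStar_empty (F : SimpleGraph V) (v : V) : addStar F v ∅ = F := by
  simp [addStar]

theorem addStar_insert [DecidableEq V] (F : SimpleGraph V) (v w : V) (L : Finset V) :
    addStar F v (insert w L) = addStar F v L ⊔ edge v w := by
  rw [addStar, addStar, Finset.sup_insert, sup_assoc, sup_comm (edge v w)]

theorem Separated.subset {F : SimpleGraph V} {v : V} {L L' : Finset V} (h : Separated F v L')
    (hL : L ⊆ L') : Separated F v L :=
  ⟨fun w hw => h.center w (hL hw), fun w hw w' hw' => h.pairwise w (hL hw) w' (hL hw')⟩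

theorem reachable_of_addStar {F : SimpleGraph V} {v w z : V} {L : Finset V}
    (hv : ¬ F.Reachable w v) (hL : ∀ w' ∈ L, ¬ F.Reachable w w')
    (h : (addStar F v L).Reachable w z) : F.Reachable w z := by
  refine mem_of_reachable_of_closed (C := {z | F.Reachable w z}) (.refl w) ?_ h
  intro a ha b hab
  rcases addStar_adj.1 hab with hab | ⟨w', hw', hab⟩
  · exact Reachable.trans ha hab.reachable
  · rcases eq_or_eq_of_edge_adj hab with ⟨rfl, rfl⟩ | ⟨rfl, rfl⟩
    · exact absurd ha hv
    · exact absurd ha (hL _ hw')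

theorem Separated.not_reachable_of_insert [DecidableEq V] {F : SimpleGraph V} {v w z : V}
    {L : Finset V}
    (h : Separated F v (insert w L)) (hw : w ∉ L) (hz : ¬ F.Reachable w z) :
    ¬ (addStar F v L).Reachable w z := fun hr =>
  hz (reachable_of_addStar (fun h' => h.center w (Finset.mem_insert_self _ _) h'.symm)
    (fun w' hw' => h.pairwise w (Finset.mem_insert_self _ _) w' (Finset.mem_insert_of_mem hw')
      (by rintro rfl; exact hw hw')) hr)

theorem Separated.not_reachable_center_of_insert [DecidableEq V] {F : SimpleGraph V} {v w : V}
    {L : Finset V} (h : Separated F v (insert w L)) (hw : w ∉ L) :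
    ¬ (addStar F v L).Reachable v w := fun hr =>
  h.not_reachable_of_insert hw
    (fun h' => h.center w (Finset.mem_insert_self _ _) h'.symm) hr.symm

theorem Separated.isAcyclic {F : SimpleGraph V} {v : V} {L : Finset V} (h : Separated F v L)
    (hF : F.IsAcyclic) : (addStar F v L).IsAcyclic := by
  classical
  induction L using Finset.induction_on with
  | empty => rwa [addStar_empty]
  | insert w L hw ih =>
    rw [addStar_insert]
    exact (ih (h.subset (Finset.subset_insert _ _))).sup_edge_of_not_reachable
      (h.not_reachable_center_of_insert hw)

/-- A connected set not connected in `F` is one of `F` through `v`, joined with connected sets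
through the members of a nonempty subset of `L`. The product also counts the empty subset; the
correction stands on the left to avoid subtraction in `ℕ`. -/
theorem connCount_addStar [Finite V] {F : SimpleGraph V} {v : V} {L : Finset V}
    (h : Separated F v L) {R : Set V} (hR : ∀ r ∈ R, ∀ w ∈ L, ¬ F.Reachable w r) :
    connCount (addStar F v L) R + connCount F (insert v R) =
      connCount F R + connCount F (insert v R) * ∏ w ∈ L, (1 + connCount F {w}) := by
  classical
  induction L using Finset.induction_on generalizing R with
  | empty => simp [addStar_empty]
  | insert w L hw ih =>
    have hsub : L ⊆ insert w L := Finset.subset_insert _ _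
    have hwv : ¬ F.Reachable w v := fun h' => h.center w (Finset.mem_insert_self _ _) h'.symm
    have ih' := @ih (h.subset hsub)
    have h₁ := ih' fun r hr w' hw' => hR r hr w' (hsub hw')
    have h₂ := @ih' (insert v R) fun r hr w' hw' => by
      rcases hr with rfl | hr
      · exact fun h' => h.center w' (hsub hw') h'.symm
      · exact hR r hr w' (hsub hw')
    have h₃ := @ih' {w} fun r hr w' hw' => by
      rw [Set.mem_singleton_iff.1 hr]
      exact h.pairwise w' (hsub hw') w (Finset.mem_insert_self _ _) (by rintro rfl; exact hw hw')
    rw [connCount_eq_zero (a := v) (b := w) (by simp) (by simp)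
      (h.center w (Finset.mem_insert_self _ _))] at h₃
    rw [Set.insert_idem] at h₂
    rw [addStar_insert, connCount_sup_edge (h.not_reachable_center_of_insert hw)
      (fun r hr => h.not_reachable_of_insert hw (hR r hr w (Finset.mem_insert_self _ _))),
      Finset.prod_insert hw]
    have h₂' : connCount (addStar F v L) (insert v R) =
      connCount F (insert v R) * ∏ w ∈ L, (1 + connCount F {w}) := by omega
    have h₃' : connCount (addStar F v L) {w} = connCount F {w} := by omega
    rw [h₂', h₃']
    linear_combination h₁

/-! ### Degrees and connectedness after changing edges -/

theorem ncard_neighborSet_sup_edge [Finite V] {F : SimpleGraph V} {a b : V} (hab : a ≠ b)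
    (h : ¬ F.Adj a b) [DecidableEq V] (z : V) :
    ((F ⊔ edge a b).neighborSet z).ncard =
      (F.neighborSet z).ncard + (if z = a then 1 else 0) + (if z = b then 1 else 0) := by
  by_cases hza : z = a
  · subst hza
    have : (F ⊔ edge z b).neighborSet z = insert b (F.neighborSet z) := by
      ext w
      simp only [mem_neighborSet, sup_adj, edge_adj, Set.mem_insert_iff]
      grind
    rw [this, Set.ncard_insert_of_notMem (by simpa using h)]
    simp [hab]
  · by_cases hzb : z = b
    · subst hzb
      have : (F ⊔ edge a z).neighborSet z = insert a (F.neighborSet z) := by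
        ext w
        simp only [mem_neighborSet, sup_adj, edge_adj, Set.mem_insert_iff]
        grind
      rw [this, Set.ncard_insert_of_notMem (by simpa using fun h' => h (Adj.symm h'))]
      simp [hza]
    · have : (F ⊔ edge a b).neighborSet z = F.neighborSet z := by
        ext w
        simp only [mem_neighborSet, sup_adj, edge_adj]
        grind
      rw [this]
      simp [hza, hzb]

theorem ncard_neighborSet_addStar [Finite V] {F : SimpleGraph V} {v : V} {L : Finset V}
    (h : Separated F v L) [DecidableEq V] (z : V) :
    ((addStar F v L).neighborSet z).ncard =
      (F.neighborSet z).ncard + (if z = v then L.card else 0) + (if z ∈ L then 1 else 0) := by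
  induction L using Finset.induction_on with
  | empty => simp [addStar_empty]
  | insert w L hw ih =>
    have hr := h.not_reachable_center_of_insert hw
    rw [addStar_insert, ncard_neighborSet_sup_edge (by rintro rfl; exact hr (.refl _))
      (fun h' => hr h'.reachable), ih (h.subset (Finset.subset_insert _ _)),
      Finset.card_insert_of_notMem hw]
    simp only [Finset.mem_insert]
    grind

theorem degree_eq_ncard [Fintype V] (G : SimpleGraph V) (v : V) [Fintype (G.neighborSet v)] :
    G.degree v = (G.neighborSet v).ncard := by
  rw [Set.ncard_eq_toFinset_card', ← card_neighborFinset_eq_degree]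
  rfl

theorem connected_of_adj_imp_reachable {T T' : SimpleGraph V} (hT : T.Connected)
    (h : ∀ a b, T.Adj a b → T'.Reachable a b) : T'.Connected := by
  have := hT.nonempty
  refine ⟨fun a b => ?_⟩
  exact mem_of_reachable_of_closed (C := {z | T'.Reachable a z}) (.refl a)
    (fun x hx y hxy => Reachable.trans hx (h x y hxy)) (hT.preconnected a b)

/-! ### Rooted trees -/

/-- `p` is the parent map and `d` the depth function of `T` when `T` is rooted at `r`. -/
structure IsRooted (T : SimpleGraph V) (r : V) (p : V → V) (d : V → ℕ) : Prop where
  root : p r = r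
  adj : ∀ v, v ≠ r → T.Adj v (p v)
  depth : ∀ v, v ≠ r → d (p v) + 1 = d v

theorem exists_isRooted {T : SimpleGraph V} (hT : T.Connected) (r : V) :
    ∃ p d, IsRooted T r p d := by
  have h : ∀ v, v ≠ r → ∃ w, T.Adj v w ∧ T.dist w r + 1 = T.dist v r := by
    intro v hv
    obtain ⟨q, hq⟩ := (hT.preconnected v r).exists_walk_length_eq_dist
    cases q with
    | nil => exact absurd rfl hv
    | @cons _ w _ hvw q =>
      refine ⟨w, hvw, ?_⟩
      have h₁ : T.dist w r ≤ q.length := dist_le q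
      obtain ⟨q', hq'⟩ := (hT.preconnected w r).exists_walk_length_eq_dist
      have h₂ : T.dist v r ≤ (Walk.cons hvw q').length := dist_le _
      rw [Walk.length_cons] at hq h₂
      omega
  choose! p hp using h
  classical
  refine ⟨fun v => if v = r then r else p v, fun v => T.dist v r, by simp, ?_, ?_⟩
  · intro v hv
    simpa [hv] using (hp v hv).1
  · intro v hv
    simpa [hv] using (hp v hv).2

namespace IsRooted

variable {T : SimpleGraph V} {r : V} {p : V → V} {d : V → ℕ}

theorem depth_parent_le (h : IsRooted T r p d) (v : V) : d (p v) ≤ d v := by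
  by_cases hv : v = r
  · rw [hv, h.root]
  · have := h.depth v hv
    omega

theorem depth_iterate_le (h : IsRooted T r p d) (v : V) (k : ℕ) : d (p^[k] v) ≤ d v := by
  induction k with
  | zero => rfl
  | succ k ih =>
    rw [Function.iterate_succ_apply']
    exact (h.depth_parent_le _).trans ih

/-- Climb along parents: only the edges on this path need to survive the deletion. -/
theorem reachable_root (h : IsRooted T r p d) {D : Set (Sym2 V)} (v : V)
    (hD : ∀ k, p^[k] v ≠ r → s(p^[k] v, p (p^[k] v)) ∉ D) :
    (T.deleteEdges D).Reachable v r := by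
  induction hn : d v using Nat.strong_induction_on generalizing v with
  | _ n ih =>
    by_cases hv : v = r
    · rw [hv]
    · have hd := h.depth v hv
      have hadj : (T.deleteEdges D).Adj v (p v) := by
        rw [deleteEdges_adj]
        exact ⟨h.adj v hv, hD 0 hv⟩
      exact hadj.reachable.trans (ih _ (by omega) (p v) (fun k hk => hD (k + 1) hk) rfl)

/-- Otherwise both ends could climb to the root without using the edge `ab`, which is a bridge. -/
theorem parent_eq_or (h : IsRooted T r p d) (hT : T.IsAcyclic) {a b : V} (hab : T.Adj a b) :
    (a ≠ r ∧ p a = b) ∨ (b ≠ r ∧ p b = a) := by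
  have key : ∀ z, (T.deleteEdges {s(a, b)}).Reachable z r ∨
      (∃ k, p^[k] z ≠ r ∧ s(p^[k] z, p (p^[k] z)) = s(a, b)) := by
    intro z
    by_contra! hz
    exact hz.1 (h.reachable_root z fun k hk hmem => hz.2 k hk hmem)
  have hbr := isAcyclic_iff_forall_adj_isBridge.1 hT hab
  rw [isBridge_iff] at hbr
  have fin : (∃ z, z ≠ r ∧ s(z, p z) = s(a, b)) → (a ≠ r ∧ p a = b) ∨ (b ≠ r ∧ p b = a) := by
    rintro ⟨z, hz, e⟩
    rw [Sym2.eq_iff] at e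
    rcases e with ⟨rfl, e⟩ | ⟨rfl, e⟩
    · exact Or.inl ⟨hz, e⟩
    · exact Or.inr ⟨hz, e⟩
  rcases key a with ha | ⟨k, hk⟩
  · rcases key b with hb | ⟨k, hk⟩
    · exact absurd (ha.trans hb.symm) hbr
    · exact fin ⟨_, hk⟩
  · exact fin ⟨_, hk⟩

theorem eq_of_edge_eq (h : IsRooted T r p d) {a b : V} (ha : a ≠ r) (hb : b ≠ r)
    (hab : s(a, p a) = s(b, p b)) : a = b := by
  rw [Sym2.eq_iff] at hab
  rcases hab with ⟨e, -⟩ | ⟨e₁, e₂⟩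
  · exact e
  · have h₁ := h.depth a ha
    have h₂ := h.depth b hb
    rw [e₂] at h₁
    rw [← e₁] at h₂
    omega

end IsRooted

/-! ### Counts for two branches attached to one component -/

section TwoEdges

variable {F : SimpleGraph V} {x y u v : V}

theorem not_reachable_sup_edge {w z : V} (hx : ¬ F.Reachable w x) (hu : ¬ F.Reachable w u)
    (hz : ¬ F.Reachable w z) : ¬ (F ⊔ edge x u).Reachable w z := fun h =>
  hz (reachable_of_addStar (v := x) (L := {u}) hx (by simpa using hu) (by simpa [addStar] using h))

theorem connCount_sup_edge_empty [Finite V] (hxu : ¬ F.Reachable x u) :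
    connCount (F ⊔ edge x u) ∅ = connCount F ∅ + connCount F {x} * connCount F {u} := by
  simpa using connCount_sup_edge hxu (R := ∅) (by simp)

/-- `x` and `y` lie in one component of `F`, `u` and `v` in two others. -/
structure TwoBranches (F : SimpleGraph V) (x y u v : V) : Prop where
  xy : F.Reachable x y
  xu : ¬ F.Reachable x u
  xv : ¬ F.Reachable x v
  uv : ¬ F.Reachable u v

theorem TwoBranches.symm (h : TwoBranches F x y u v) : TwoBranches F y x v u :=
  ⟨h.xy.symm, fun h' => h.xv (h.xy.trans h'), fun h' => h.xu (h.xy.trans h'),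
    fun h' => h.uv h'.symm⟩

theorem TwoBranches.exchange (h : TwoBranches F x y u v) : TwoBranches F y x u v :=
  ⟨h.xy.symm, fun h' => h.xu (h.xy.trans h'), fun h' => h.xv (h.xy.trans h'), h.uv⟩

theorem TwoBranches.not_reachable (h : TwoBranches F x y u v) {z : V} (hz : ¬ F.Reachable v z) :
    ¬ (F ⊔ edge x u).Reachable v z :=
  not_reachable_sup_edge (fun h' => h.xv h'.symm) (fun h' => h.uv h'.symm) hz

theorem TwoBranches.isAcyclic (h : TwoBranches F x y u v) (hF : F.IsAcyclic) :
    (F ⊔ edge x u ⊔ edge y v).IsAcyclic :=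
  (hF.sup_edge_of_not_reachable h.xu).sup_edge_of_not_reachable
    fun h' => h.not_reachable (fun h'' => h.symm.xu h''.symm) h'.symm

theorem TwoBranches.connCount_eq [Finite V] (h : TwoBranches F x y u v) {R : Set V}
    (hR : ∀ r ∈ R, ¬ F.Reachable v r) :
    connCount (F ⊔ edge x u ⊔ edge y v) R = connCount (F ⊔ edge x u) R +
      connCount (F ⊔ edge x u) (insert y R) * connCount F {v} := by
  have h₁ : connCount (F ⊔ edge x u) {v} = connCount F {v} := by
    rw [connCount_sup_edge h.xu (by simpa using h.uv),
      connCount_eq_zero (F := F) (a := x) (b := v) (R := {x, v}) (by simp) (by simp) h.xv]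
    simp
  rw [connCount_sup_edge (fun h' => h.not_reachable (fun h'' => h.symm.xu h''.symm) h'.symm)
    (fun r hr => h.not_reachable (hR r hr)), h₁]

/-- The four terms correspond to using neither new edge, only `xu`, only `yv`, or both. The case `x
= y` is allowed and serves for paths of length two. -/
theorem TwoBranches.connCount_empty [Finite V] (h : TwoBranches F x y u v) :
    connCount (F ⊔ edge x u ⊔ edge y v) ∅ = connCount F ∅ + connCount F {x} * connCount F {u} +
      (connCount F {y} + connCount F {x, y} * connCount F {u}) * connCount F {v} := by
  rw [h.connCount_eq (by simp), connCount_sup_edge_empty h.xu, insert_empty_eq,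
    connCount_sup_edge h.xu (by simpa using fun h' => h.symm.xv h'.symm)]

theorem TwoBranches.connCount_left [Finite V] (h : TwoBranches F x y u v) :
    connCount (F ⊔ edge x u ⊔ edge y v) {x} = connCount F {x} * (1 + connCount F {u}) +
      connCount F {x, y} * (1 + connCount F {u}) * connCount F {v} := by
  have hux : ¬ F.Reachable u x := fun h' => h.xu h'.symm
  have huy : ¬ F.Reachable u y := fun h' => h.symm.xv h'.symm
  rw [h.connCount_eq (by simpa using fun h' => h.xv h'.symm), connCount_sup_edge h.xu
    (by simpa using hux), connCount_sup_edge h.xu (by simp [hux, huy]), Set.pair_eq_singleton,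
    Set.pair_comm y x, Set.insert_eq_of_mem (a := x) (s := {x, y}) (by simp)]
  ring

theorem TwoBranches.connCount_branch [Finite V] (h : TwoBranches F x y u v) :
    connCount (F ⊔ edge x u ⊔ edge y v) {u} = connCount F {u} + connCount F {x} * connCount F {u} +
      connCount F {x, y} * connCount F {u} * connCount F {v} := by
  have huy : ¬ F.Reachable u y := fun h' => h.symm.xv h'.symm
  have h₁ := connCount_sup_edge_union h.xu (R := ∅) (Q := {u}) (by simp) (by simpa using h.xu)
  have h₂ := connCount_sup_edge_union h.xu (R := {y}) (Q := {u}) (by simpa using huy)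
    (by simpa using h.xu)
  rw [connCount_eq_zero (F := F) (a := u) (b := y) (R := {y} ∪ {u}) (by simp) (by simp) huy] at h₂
  rw [h.connCount_eq (by simpa using fun h' => h.uv h'.symm)]
  simp only [Set.empty_union, insert_empty_eq, Set.singleton_union, Set.pair_eq_singleton] at h₁ h₂
  rw [h₁, h₂]
  ring

end TwoEdges

/-! ### Cutting branches off a tree -/

theorem sup_edge_deleteEdges {T : SimpleGraph V} {x y u v : V} (hxu : T.Adj x u)
    (hyv : T.Adj y v) :
    T.deleteEdges {s(x, u), s(y, v)} ⊔ edge x u ⊔ edge y v = T := by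
  ext a b
  simp only [sup_adj, deleteEdges_adj, edge_adj, Set.mem_insert_iff, Set.mem_singleton_iff,
    Sym2.eq_iff]
  have := hxu.ne
  have := hyv.ne
  have := hxu.symm
  have := hyv.symm
  grind

theorem twoBranches_deleteEdges {T : SimpleGraph V} (hT : T.IsAcyclic) {x y u v : V}
    (hxu : T.Adj x u) (hyv : T.Adj y v) (huv : u ≠ v)
    (hxy : (T.deleteEdges {s(x, u), s(y, v)}).Reachable x y) :
    TwoBranches (T.deleteEdges {s(x, u), s(y, v)}) x y u v := by
  have h₁ := isAcyclic_iff_forall_adj_isBridge.1 hT hxu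
  have h₂ := isAcyclic_iff_forall_adj_isBridge.1 hT hyv
  rw [isBridge_iff] at h₁ h₂
  have le₁ : T.deleteEdges {s(x, u), s(y, v)} ≤ T.deleteEdges {s(x, u)} :=
    deleteEdges_anti (by simp)
  have le₂ : T.deleteEdges {s(x, u), s(y, v)} ≤ T.deleteEdges {s(y, v)} :=
    deleteEdges_anti (by simp)
  have xu : ¬ (T.deleteEdges {s(x, u), s(y, v)}).Reachable x u := fun h => h₁ (h.mono le₁)
  have yv : ¬ (T.deleteEdges {s(x, u), s(y, v)}).Reachable y v := fun h => h₂ (h.mono le₂)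
  refine ⟨hxy, xu, fun h => yv (hxy.symm.trans h), fun h => ?_⟩
  have hadj : (T.deleteEdges {s(x, u)}).Adj y v := by
    rw [deleteEdges_adj]
    refine ⟨hyv, fun hm => ?_⟩
    rw [Set.mem_singleton_iff, Sym2.eq_iff] at hm
    rcases hm with ⟨-, e⟩ | ⟨e, -⟩
    · exact huv e.symm
    · exact xu (e ▸ hxy)
  exact h₁ ((hxy.mono le₁).trans (hadj.reachable.trans (h.symm.mono le₁)))

theorem addStar_deleteEdges {T : SimpleGraph V} {v : V} {L : Finset V}
    (hL : ∀ w ∈ L, T.Adj v w) :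
    addStar (T.deleteEdges ((fun w => s(v, w)) '' L)) v L = T := by
  ext a b
  rw [addStar_adj, deleteEdges_adj]
  constructor
  · rintro (h | ⟨w, hw, h⟩)
    · exact h.1
    · rcases eq_or_eq_of_edge_adj h with ⟨rfl, rfl⟩ | ⟨rfl, rfl⟩
      · exact hL _ hw
      · exact (hL _ hw).symm
  · intro h
    by_cases hm : s(a, b) ∈ (fun w => s(v, w)) '' (L : Set V)
    · obtain ⟨w, hw, e⟩ := hm
      refine Or.inr ⟨w, hw, ?_⟩
      have e : s(v, w) = s(a, b) := e
      rw [Sym2.eq_iff] at e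
      have := h.ne
      rw [edge_adj]
      grind
    · exact Or.inl ⟨h, hm⟩

theorem separated_deleteEdges {T : SimpleGraph V} (hT : T.IsAcyclic) {v : V} {L : Finset V}
    (hL : ∀ w ∈ L, T.Adj v w) :
    Separated (T.deleteEdges ((fun w => s(v, w)) '' L)) v L := by
  have hbr : ∀ w ∈ L, ¬ (T.deleteEdges {s(v, w)}).Reachable v w := fun w hw =>
    isBridge_iff.1 (isAcyclic_iff_forall_adj_isBridge.1 hT (hL w hw))
  have hle : ∀ w ∈ L, T.deleteEdges ((fun w => s(v, w)) '' L) ≤ T.deleteEdges {s(v, w)} :=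
    fun w hw => deleteEdges_anti (by simpa using ⟨w, hw, Or.inl rfl⟩)
  refine ⟨fun w hw h => hbr w hw (h.mono (hle w hw)), fun w hw w' hw' hne h => ?_⟩
  have hadj : (T.deleteEdges {s(v, w)}).Adj v w' := by
    rw [deleteEdges_adj]
    refine ⟨hL _ hw', fun hm => ?_⟩
    rw [Set.mem_singleton_iff, Sym2.eq_iff] at hm
    rcases hm with ⟨-, e⟩ | ⟨e, -⟩
    · exact hne e.symm
    · exact (hL w hw).ne e
  exact hbr w hw (hadj.reachable.trans (h.symm.mono (hle w hw)))

/-! ### Optimal trees and exchange arguments -/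

/-- `T` is a tree with degree sequence `π` that has as many subtrees as any other such tree on the
same vertex set. -/
def IsOptimal [Fintype V] {n : ℕ} (π : Fin n → ℕ) (T : SimpleGraph V) : Prop :=
  T.IsTree ∧ HasDegreeSequence T π ∧
    ∀ T' : SimpleGraph V, T'.IsTree → HasDegreeSequence T' π → connCount T' ∅ ≤ connCount T ∅

theorem HasDegreeSequence.of_perm [Fintype V] {n : ℕ} {π : Fin n → ℕ} {T T' : SimpleGraph V}
    (h : HasDegreeSequence T π) (σ : V ≃ V)
    (hσ : ∀ z, (T'.neighborSet (σ z)).ncard = (T.neighborSet z).ncard) :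
    HasDegreeSequence T' π := by
  obtain ⟨e, he⟩ := h
  refine ⟨e.trans σ, fun i => ?_⟩
  rw [degree_eq_ncard, Equiv.trans_apply, hσ, ← he i, degree_eq_ncard]

theorem connCount_lt_of_path [Finite V] {T : SimpleGraph V} (hT : T.IsAcyclic) {a b c : V}
    (hba : T.Adj b a) (hbc : T.Adj b c) (hac : a ≠ c)
    (hle : connCount T {b} ≤ connCount T {a}) : connCount T {c} < connCount T {b} := by
  have h := twoBranches_deleteEdges hT hba hbc hac (.refl b)
  have hsup := sup_edge_deleteEdges hba hbc
  set F := T.deleteEdges {s(b, a), s(b, c)}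
  have hb := h.connCount_left
  have ha := h.connCount_branch
  have hc := h.symm.connCount_branch
  rw [sup_right_comm] at hc
  rw [hsup] at ha hb hc
  rw [Set.pair_eq_singleton] at ha hb hc
  have hpos := connCount_singleton_pos F b
  have hpos' := connCount_singleton_pos F c
  rw [ha, hb] at hle
  rw [hb, hc]
  generalize connCount F {a} = p at *
  generalize connCount F {b} = q at *
  generalize connCount F {c} = s at *
  -- The counts in `T` are f(a) = p(1 + q(1 + s)), f(b) = q(1 + p)(1 + s) and f(c) = s(1 + q(1 +
  -- p)), so `hle` reduces to this bound.
  have h₁ : q * (1 + s) ≤ p := by nlinarith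
  have h₂ : s < p := by nlinarith
  nlinarith

/-- `A`, `B`, `c` stand for the counts of `F` at `x`, `y` and at both, `p`, `q` for those at `u`,
`v`. Optimality is `h`, that is (A - B)(p - q) ≥ 0. If A ≠ B, it gives both strict inequalities the
sign of B - A; if A = B, both reduce to p < q. -/
theorem swap_arith {A B c p q : ℤ} (hcA : c < A) (hcB : c < B) (hp : 0 < p) (hq : 0 < q)
    (hc : 0 ≤ c) (h : B * p + A * q ≤ A * p + B * q) :
    A * (1 + p) + c * (1 + p) * q < B * (1 + q) + c * (1 + q) * p ↔
      p + A * p + c * p * q < q + B * q + c * q * p := by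
  have h' : 0 ≤ (A - B) * (p - q) := by linarith
  rcases lt_trichotomy A B with hAB | rfl | hAB
  · have hpq : p ≤ q := by nlinarith
    constructor <;> intro _ <;>
      nlinarith [mul_nonneg (sub_nonneg.2 hpq) (sub_nonneg.2 hcA.le), mul_pos hq (sub_pos.2 hAB)]
  · constructor
    · intro k
      have : p < q := by
        by_contra hn
        nlinarith [mul_nonneg (sub_nonneg.2 (not_lt.1 hn)) (sub_nonneg.2 hcA.le)]
      nlinarith
    · intro k
      have : p < q := by
        by_contra hn
        nlinarith
      nlinarith [mul_pos (sub_pos.2 this) (sub_pos.2 hcA)]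
  · have hpq : q ≤ p := by nlinarith
    constructor <;> intro _ <;>
      nlinarith [mul_nonneg (sub_nonneg.2 hpq) (sub_nonneg.2 hcB.le), mul_pos hp (sub_pos.2 hAB)]

/-- Exchanging two branches of an optimal tree. -/
theorem IsOptimal.connCount_lt_iff [Fintype V] {n : ℕ} {π : Fin n → ℕ} {T : SimpleGraph V}
    (hT : IsOptimal π T) {x y u v : V} (hxu : T.Adj x u) (hyv : T.Adj y v) (huv : u ≠ v)
    (hne : x ≠ y) (hxy : (T.deleteEdges {s(x, u), s(y, v)}).Reachable x y) :
    connCount T {x} < connCount T {y} ↔ connCount T {u} < connCount T {v} := by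
  classical
  have h := twoBranches_deleteEdges hT.1.isAcyclic hxu hyv huv hxy
  have hsup := sup_edge_deleteEdges hxu hyv
  have hFle : T.deleteEdges {s(x, u), s(y, v)} ≤ T := deleteEdges_le _
  set F := T.deleteEdges {s(x, u), s(y, v)}
  have hx := h.connCount_left
  have hu := h.connCount_branch
  have hy := h.symm.connCount_left
  have hv := h.symm.connCount_branch
  have h₀ := h.connCount_empty
  rw [sup_right_comm] at hy hv
  rw [hsup] at hx hu hy hv h₀
  have h₀' := h.exchange.connCount_empty
  have hyu : ¬ F.Reachable y u := h.exchange.xu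
  have huxv : ∀ {a}, F.Reachable a u → a ≠ x ∧ a ≠ y ∧ a ≠ v := fun ha =>
    ⟨by rintro rfl; exact h.xu ha, by rintro rfl; exact hyu ha,
      by rintro rfl; exact h.uv ha.symm⟩
  obtain ⟨hux', huy', huv'⟩ := huxv (.refl u)
  have hvx : v ≠ x := by rintro rfl; exact h.xv (.refl _)
  have hvy : v ≠ y := by rintro rfl; exact h.xv hxy
  have hdeg : ∀ z, ((F ⊔ edge y u ⊔ edge x v).neighborSet z).ncard = (T.neighborSet z).ncard := by
    intro z
    conv_rhs => rw [← hsup]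
    rw [ncard_neighborSet_sup_edge hvx.symm, ncard_neighborSet_sup_edge huy'.symm,
      ncard_neighborSet_sup_edge hvy.symm, ncard_neighborSet_sup_edge hux'.symm]
    · ring
    · exact fun h' => h.xu h'.reachable
    · exact fun h' => h.not_reachable (fun h'' => h.symm.xu h''.symm) h'.symm.reachable
    · exact fun h' => hyu h'.reachable
    · exact fun h' => h.exchange.not_reachable (fun h'' => h.xv h''.symm) h'.symm.reachable
  have htree : (F ⊔ edge y u ⊔ edge x v).IsTree := by
    refine ⟨connected_of_adj_imp_reachable hT.1.connected fun a b hab => ?_,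
      h.exchange.isAcyclic (hT.1.isAcyclic.anti hFle)⟩
    have rxy : (F ⊔ edge y u ⊔ edge x v).Reachable x y :=
      hxy.mono (le_sup_left.trans le_sup_left)
    have ryu : (F ⊔ edge y u ⊔ edge x v).Reachable y u :=
      Adj.reachable (by simp [edge_adj, huy'.symm])
    have rxv : (F ⊔ edge y u ⊔ edge x v).Reachable x v :=
      Adj.reachable (by simp [edge_adj, hvx.symm])
    rw [← hsup] at hab
    rcases hab with (hab | hab) | hab
    · exact Adj.reachable (Or.inl (Or.inl hab))
    · rcases eq_or_eq_of_edge_adj hab with ⟨rfl, rfl⟩ | ⟨rfl, rfl⟩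
      · exact rxy.trans ryu
      · exact (rxy.trans ryu).symm
    · rcases eq_or_eq_of_edge_adj hab with ⟨rfl, rfl⟩ | ⟨rfl, rfl⟩
      · exact rxy.symm.trans rxv
      · exact (rxy.symm.trans rxv).symm
  have hle := hT.2.2 _ htree (hT.2.1.of_perm (Equiv.refl V) hdeg)
  rw [h₀, h₀', Set.pair_comm y x] at hle
  rw [Set.pair_comm y x] at hy hv
  have hcA := connCount_pair_lt F hne.symm
  have hcB := connCount_pair_lt F hne
  rw [Set.pair_comm y x] at hcA
  have hp := connCount_singleton_pos F u
  have hq := connCount_singleton_pos F v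
  have key := @swap_arith (connCount F {x}) (connCount F {y}) (connCount F {x, y})
    (connCount F {u}) (connCount F {v}) (by exact_mod_cast hcA) (by exact_mod_cast hcB)
    (by exact_mod_cast hp) (by exact_mod_cast hq) (by positivity) (by
      zify at hle
      linarith)
  rw [hx, hy, hu, hv]
  exact_mod_cast key

/-- In an optimal tree, vertices in more subtrees have at least the degree of the others. -/
theorem IsOptimal.ncard_neighborSet_le [Fintype V] {n : ℕ} {π : Fin n → ℕ} {T : SimpleGraph V}
    (hT : IsOptimal π T) {u v : V} (hle : connCount T {v} ≤ connCount T {u}) :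
    (T.neighborSet v).ncard ≤ (T.neighborSet u).ncard := by
  classical
  by_contra! hlt
  have huv : u ≠ v := by rintro rfl; exact lt_irrefl _ hlt
  obtain ⟨p, d, hp⟩ := exists_isRooted hT.1.connected u
  have hpos : 0 < (T.neighborSet u).ncard := by
    have : Nontrivial V := ⟨u, v, huv⟩
    obtain ⟨w, hw⟩ := hT.1.connected.preconnected.exists_adj_of_nontrivial u
    exact (Set.ncard_pos (Set.toFinite _)).2 ⟨w, hw⟩
  -- The branches to move number deg v - deg u and avoid the one towards `u`; enough remain because
  -- deg u ≥ 1.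
  obtain ⟨L, hLsub, hLcard⟩ := Finset.exists_subset_card_eq
    (s := (T.neighborSet v \ {p v}).toFinset) (n := (T.neighborSet v).ncard - (T.neighborSet u).ncard)
    (by
      rw [← Set.ncard_eq_toFinset_card', Set.ncard_sdiff_singleton_of_mem
        (show p v ∈ T.neighborSet v from hp.adj v huv.symm)]
      omega)
  have hL : ∀ w ∈ L, T.Adj v w ∧ w ≠ p v := fun w hw => by simpa using hLsub hw
  have hsep := separated_deleteEdges hT.1.isAcyclic (fun w hw => (hL w hw).1)
  have hstar := addStar_deleteEdges (fun w hw => (hL w hw).1)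
  have hFle : T.deleteEdges ((fun w => s(v, w)) '' (L : Set V)) ≤ T := deleteEdges_le _
  have hreach : (T.deleteEdges ((fun w => s(v, w)) '' (L : Set V))).Reachable v u := by
    refine hp.reachable_root v ?_
    rintro k hk ⟨w, hw, e⟩
    have e : s(v, w) = s(p^[k] v, p (p^[k] v)) := e
    rcases hp.parent_eq_or hT.1.isAcyclic (hL w hw).1 with ⟨-, h⟩ | ⟨hwu, h⟩
    · exact (hL w hw).2 h.symm
    · rw [Sym2.eq_swap (a := v)] at e
      nth_rw 1 [← h] at e
      have e' := hp.eq_of_edge_eq hwu hk e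
      have h₁ := hp.depth_iterate_le v k
      have h₂ := hp.depth w hwu
      rw [← e', ← h] at h₁
      omega
  set F := T.deleteEdges ((fun w => s(v, w)) '' (L : Set V))
  have huL : ∀ w ∈ L, ¬ F.Reachable w u := fun w hw h =>
    hsep.center w hw (hreach.trans h.symm)
  have hvL : ∀ w ∈ L, ¬ F.Reachable w v := fun w hw h => hsep.center w hw h.symm
  have hsep' : Separated F u L := ⟨fun w hw h => huL w hw h.symm, hsep.pairwise⟩
  have hdeg : ∀ z, ((addStar F u L).neighborSet (Equiv.swap u v z)).ncard =
      (T.neighborSet z).ncard := by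
    intro z
    have du := ncard_neighborSet_addStar hsep u
    have dv := ncard_neighborSet_addStar hsep v
    have dz := ncard_neighborSet_addStar hsep z
    rw [ncard_neighborSet_addStar hsep']
    rw [hstar] at du dv dz
    have hu' : u ∉ L := fun h => huL u h (.refl u)
    have hv' : v ∉ L := fun h => hvL v h (.refl v)
    simp only [hu', hv', huv, if_true, if_false] at du dv
    by_cases hzu : z = u
    · subst hzu
      simp only [Equiv.swap_apply_left, hv', huv.symm, if_false]
      omega
    · by_cases hzv : z = v
      · subst hzv
        simp only [Equiv.swap_apply_right, hu', if_true, if_false]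
        omega
      · rw [Equiv.swap_apply_of_ne_of_ne hzu hzv, dz]
        simp [hzu, hzv]
  have htree : (addStar F u L).IsTree := by
    refine ⟨connected_of_adj_imp_reachable hT.1.connected fun a b hab => ?_,
      hsep'.isAcyclic (hT.1.isAcyclic.anti hFle)⟩
    have rvu : (addStar F u L).Reachable v u := hreach.mono le_sup_left
    have ruw : ∀ w ∈ L, (addStar F u L).Reachable u w := fun w hw =>
      Adj.reachable (addStar_adj.2 (Or.inr ⟨w, hw, by
        have : u ≠ w := by rintro rfl; exact huL _ hw (.refl _)
        simp [edge_adj, this]⟩))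
    rw [← hstar] at hab
    rcases addStar_adj.1 hab with hab | ⟨w, hw, hab⟩
    · exact Adj.reachable (addStar_adj.2 (Or.inl hab))
    · rcases eq_or_eq_of_edge_adj hab with ⟨rfl, rfl⟩ | ⟨rfl, rfl⟩
      · exact rvu.trans (ruw _ hw)
      · exact (rvu.trans (ruw _ hw)).symm
  have hopt := hT.2.2 _ htree (hT.2.1.of_perm _ hdeg)
  have c₁ := connCount_addStar hsep (R := ∅) (by simp)
  have c₂ := connCount_addStar hsep' (R := ∅) (by simp)
  have c₃ := connCount_addStar hsep (R := {v}) (by simpa using hvL)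
  have c₄ := connCount_addStar hsep (R := {u}) (by simpa using huL)
  rw [hstar] at c₁ c₃ c₄
  simp only [insert_empty_eq, Set.pair_eq_singleton] at c₁ c₂ c₃
  have hlt' := connCount_pair_lt F huv
  rw [Set.pair_comm v u] at c₄
  obtain ⟨w, hw⟩ : L.Nonempty := Finset.card_pos.1 (by omega)
  have hY : 2 ≤ ∏ w ∈ L, (1 + connCount F {w}) := by
    have := Finset.single_le_prod' (f := fun w => 1 + connCount F {w})
      (fun i _ => Nat.le_add_right 1 _) hw
    have h₂ := connCount_singleton_pos F w
    omega
  generalize ∏ w ∈ L, (1 + connCount F {w}) = Y at *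
  zify at *
  -- Moving `L` to `u` changes the total by (f_F(u) - f_F(v))(Y - 1), which optimality makes
  -- nonpositive. The contradiction then comes from f_T(v) = f_F(v) Y and f_T(u) = f_F(u) + c(Y -
  -- 1), where c, the count of `F` at both, is below f_F(v).
  have h₁ : (connCount F {u} : ℤ) ≤ connCount F {v} := by
    by_contra! hn
    nlinarith
  nlinarith

/-! ### Recognising the greedy tree -/

/-- A rooted tree on `Fin n` whose labels increase from parents to children in breadth-first order
is the greedy tree. -/
theorem iso_greedyTree {n : ℕ} {π : Fin n → ℕ} {T : SimpleGraph (Fin n)} (hT : T.IsAcyclic)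
    {r : Fin n} {p : Fin n → Fin n} {d : Fin n → ℕ} (hp : IsRooted T r p d)
    (e : Fin n ≃ Fin n) (hr : ∀ v, e.symm r ≤ v)
    (hmono : ∀ i j, e i ≠ r → e j ≠ r → i ≤ j → e.symm (p (e i)) ≤ e.symm (p (e j)))
    (hdeg : ∀ i, (T.neighborSet (e i)).ncard = π i) : Nonempty (T ≃g greedyTree π) := by
  have hroot : ∀ i, e i = r ↔ i.val = 0 := by
    intro i
    have h0 : (e.symm r).val = 0 := by
      have := Fin.le_def.1 (hr ⟨0, (e.symm r).pos⟩)
      simpa using this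
    rw [← Equiv.eq_symm_apply, Fin.ext_iff, h0]
  set q : Fin n → Fin n := fun j => e.symm (p (e j)) with hq
  have hchildren : ∀ i, (Finset.univ.filter fun j : Fin n => j.val ≠ 0 ∧ q j = i).card =
      numChildren π i := by
    intro i
    have himg : e '' {j : Fin n | j.val ≠ 0 ∧ q j = i} = {w | w ≠ r ∧ p w = e i} := by
      ext w
      constructor
      · rintro ⟨j, ⟨hj, rfl⟩, rfl⟩
        exact ⟨fun h => hj ((hroot j).1 h), by simp [hq]⟩
      · rintro ⟨hw, h⟩
        refine ⟨e.symm w, ⟨fun h' => hw ?_, by simp [hq, h]⟩, by simp⟩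
        simpa using (hroot _).2 h'
    have hcard : (Finset.univ.filter fun j : Fin n => j.val ≠ 0 ∧ q j = i).card =
        {w | w ≠ r ∧ p w = e i}.ncard := by
      rw [← himg, Set.ncard_image_of_injective _ e.injective, Set.ncard_eq_toFinset_card']
      congr 1
      ext j
      simp
    rw [hcard, numChildren]
    split_ifs with hi
    · rw [← hdeg i]
      congr 1
      ext w
      have hi' := (hroot i).2 hi
      constructor
      · rintro ⟨hw, h⟩
        exact (h ▸ hp.adj w hw).symm
      · intro h
        rcases hp.parent_eq_or hT h with ⟨h', -⟩ | h
        · exact absurd hi' h'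
        · exact h
    · have hi' : e i ≠ r := fun h => hi ((hroot i).1 h)
      rw [← hdeg i, ← Set.ncard_sdiff_singleton_of_mem
        (show p (e i) ∈ T.neighborSet (e i) from hp.adj _ hi')]
      congr 1
      ext w
      constructor
      · rintro ⟨hw, h⟩
        refine ⟨(h ▸ hp.adj w hw).symm, ?_⟩
        rintro rfl
        have h₁ := hp.depth _ hw
        have h₂ := hp.depth _ hi'
        rw [h] at h₁
        omega
      · rintro ⟨h, hne⟩
        rcases hp.parent_eq_or hT h with ⟨-, h'⟩ | h
        · exact absurd h'.symm hne
        · exact h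
  have hfirst : ∀ i : ℕ, firstChild π i =
      1 + (Finset.univ.filter fun j : Fin n => j.val ≠ 0 ∧ (q j).val < i).card := by
    intro i
    rw [firstChild, Finset.card_eq_sum_card_fiberwise (f := q)
      (t := Finset.univ.filter fun k : Fin n => k.val < i)]
    · congr 1
      refine Finset.sum_congr rfl fun k hk => ?_
      rw [← hchildren k, Finset.filter_filter]
      congr 1
      ext j
      simp only [Finset.mem_filter, Finset.mem_univ, true_and] at hk ⊢
      constructor
      · rintro ⟨h, rfl⟩
        exact ⟨⟨h, hk⟩, rfl⟩
      · rintro ⟨⟨h, -⟩, h'⟩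
        exact ⟨h, h'⟩
    · intro j hj
      simp only [Finset.coe_filter, Finset.mem_univ, true_and, Set.mem_ofPred_eq] at hj ⊢
      exact hj.2
  -- As `q` is monotone on nonzero labels, those with `q j < i` form an initial segment starting at
  -- 1, whose length is given by `hfirst`.
  have hlt : ∀ (i : ℕ) (j : Fin n), j.val ≠ 0 → ((q j).val < i ↔ j.val < firstChild π i) := by
    intro i j hj
    rw [hfirst]
    have hn : 0 < n := j.pos
    have mono : ∀ a b : Fin n, a.val ≠ 0 → b.val ≠ 0 → a ≤ b → (q a).val ≤ (q b).val :=
      fun a b ha hb hab => hmono a b (fun h => ha ((hroot a).1 h)) (fun h => hb ((hroot b).1 h)) hab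
    constructor
    · intro h
      have hsub : Finset.Ioc (⟨0, hn⟩ : Fin n) j ⊆
          Finset.univ.filter fun j : Fin n => j.val ≠ 0 ∧ (q j).val < i := by
        intro k hk
        rw [Finset.mem_Ioc, Fin.lt_def] at hk
        have hk0 : k.val ≠ 0 := Nat.pos_iff_ne_zero.1 hk.1
        simp only [Finset.mem_filter, Finset.mem_univ, true_and]
        exact ⟨hk0, (mono k j hk0 hj hk.2).trans_lt h⟩
      have := Finset.card_le_card hsub
      rw [Fin.card_Ioc] at this
      simp only at this
      omega
    · intro h
      by_contra hn'
      have hsub : (Finset.univ.filter fun j : Fin n => j.val ≠ 0 ∧ (q j).val < i) ⊆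
          Finset.Ioo (⟨0, hn⟩ : Fin n) j := by
        intro k hk
        simp only [Finset.mem_filter, Finset.mem_univ, true_and] at hk
        rw [Finset.mem_Ioo, Fin.lt_def]
        refine ⟨Nat.pos_of_ne_zero hk.1, ?_⟩
        by_contra hjk
        have := mono j k hj hk.1 (not_lt.1 hjk)
        omega
      have := Finset.card_le_card hsub
      rw [Fin.card_Ioo] at this
      simp only at this
      omega
  have hrel : ∀ i j : Fin n, (firstChild π i.val ≤ j.val ∧ j.val < firstChild π (i.val + 1)) ↔
      e j ≠ r ∧ p (e j) = e i := by
    intro i j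
    have hpq : p (e j) = e i ↔ q j = i := by rw [hq, Equiv.symm_apply_eq]
    rw [hpq, Ne, hroot]
    by_cases hj : j.val = 0
    · have : ¬ firstChild π i.val ≤ j.val := by
        rw [hfirst]
        omega
      simp [hj]
      omega
    · rw [← hlt _ j hj, ← not_lt, ← hlt _ j hj, Fin.ext_iff]
      omega
  refine ⟨(⟨e, ?_⟩ : greedyTree π ≃g T).symm⟩
  intro i j
  rw [greedyTree, fromRel_adj, hrel, hrel]
  constructor
  · intro h
    exact ⟨fun hij => h.ne (congrArg e hij), (hp.parent_eq_or hT h).symm⟩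
  · rintro ⟨-, ⟨h, h'⟩ | ⟨h, h'⟩⟩
    · exact (h' ▸ hp.adj _ h).symm
    · exact h' ▸ hp.adj _ h

/-! ### Breadth-first order on an optimal tree -/

/-- Base-`n` codes of the paths from the root, with digits `t`. -/
theorem exists_code {T : SimpleGraph V} {r : V} {p : V → V} {d : V → ℕ}
    (hp : IsRooted T r p d) (n : ℕ) (t : V → ℕ) :
    ∃ K : V → ℕ, K r = 1 ∧ ∀ v, v ≠ r → K v = n * K (p v) + t v := by
  classical
  -- Recursion on a depth bound, later set to `d v`. The test `v = r` is needed because `d r` may be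
  -- nonzero.
  let K' : ℕ → V → ℕ := fun m => Nat.rec (fun _ => 1)
    (fun _ K v => if v = r then 1 else n * K (p v) + t v) m
  refine ⟨fun v => K' (d v) v, ?_, fun v hv => ?_⟩
  · cases h : d r with
    | zero => simp only [h]; rfl
    | succ m => simp only [h]; exact if_pos rfl
  · have h := hp.depth v hv
    simp only [← h]
    exact if_neg hv

theorem IsOptimal.nonempty_iso {n : ℕ} {π : Fin n → ℕ} (hanti : Antitone π)
    {T : SimpleGraph (Fin n)} (hT : IsOptimal π T) : Nonempty (T ≃g greedyTree π) := by
  set f : Fin n → ℕ := fun v => connCount T {v}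
  have hac := hT.1.isAcyclic
  have := hT.1.connected.nonempty
  obtain ⟨r, hrmax⟩ := Finite.exists_max f
  obtain ⟨p, d, hp⟩ := exists_isRooted hT.1.connected r
  have hparent : ∀ v, f v ≤ f (p v) := by
    intro v
    induction hm : d v using Nat.strong_induction_on generalizing v with
    | _ m ih =>
      by_cases hv : v = r
      · rw [hv, hp.root]
      · by_cases hpv : p v = r
        · rw [hpv]; exact hrmax v
        · have h₁ := hp.depth v hv
          have h₂ := hp.depth _ hpv
          refine (connCount_lt_of_path hac (hp.adj _ hpv) (hp.adj _ hv).symm ?_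
            (ih _ (by omega) (p v) rfl)).le
          intro h
          rw [h] at h₂
          omega
  have hanc : ∀ k v, f v ≤ f (p^[k] v) := by
    intro k v
    induction k with
    | zero => rfl
    | succ k ih => rw [Function.iterate_succ_apply']; exact ih.trans (hparent _)
  set σ := Tuple.sort (fun v => OrderDual.toDual (f v))
  have hσm : ∀ i j, i ≤ j → f (σ j) ≤ f (σ i) := fun i j hij =>
    Tuple.monotone_sort (fun v => OrderDual.toDual (f v)) hij
  -- Digits are ranks by decreasing f, all below `n`, so division by `n` recovers the parent's code.
  -- The leading 1 makes deeper codes larger; hence `K` orders vertices breadth first.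
  obtain ⟨K, hKr, hK⟩ := exists_code hp n (fun v => (σ.symm v).val)
  have hKpos : ∀ v, 0 < K v := by
    intro v
    induction hm : d v using Nat.strong_induction_on generalizing v with
    | _ m ih =>
      by_cases hv : v = r
      · rw [hv, hKr]; exact one_pos
      · have := hp.depth v hv
        have := ih _ (by omega) (p v) rfl
        rw [hK v hv]
        exact Nat.add_pos_left (Nat.mul_pos v.pos this) _
  have hdiv : ∀ v, v ≠ r → K v / n = K (p v) := fun v hv => by
    rw [hK v hv, Nat.mul_add_div v.pos, Nat.div_eq_of_lt (σ.symm v).isLt, add_zero]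
  have hKr_lt : ∀ v, v ≠ r → K r < K v := by
    intro v hv
    have hn : 2 ≤ n := by
      have := v.isLt
      have := r.isLt
      have : v.val ≠ r.val := fun h => hv (Fin.ext h)
      omega
    rw [hKr, hK v hv]
    have := hKpos (p v)
    nlinarith
  have hKp : ∀ v, K (p v) ≤ K v := by
    intro v
    by_cases hv : v = r
    · rw [hv, hp.root]
    · rw [← hdiv v hv]
      exact Nat.div_le_self _ _
  have hKanc : ∀ k v, K (p^[k] v) ≤ K v := by
    intro k v
    induction k with
    | zero => rfl
    | succ k ih => rw [Function.iterate_succ_apply']; exact (hKp _).trans ih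
  have hKinj : Function.Injective K := by
    intro u v huv
    by_cases hu : u = r
    · by_contra hne
      have := hKr_lt v (by rintro rfl; exact hne hu)
      rw [hu] at huv
      omega
    · by_cases hv : v = r
      · have := hKr_lt u hu
        rw [hv] at huv
        omega
      · have h₁ := hdiv u hu
        have h₂ := hdiv v hv
        have h₃ := hK u hu
        have h₄ := hK v hv
        rw [huv, h₂] at h₁
        rw [← h₁] at h₃
        exact σ.symm.injective (Fin.ext (by omega))
  have hKmono : ∀ u v, u ≠ r → v ≠ r → K u ≤ K v → K (p u) ≤ K (p v) := by
    intro u v hu hv h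
    rw [← hdiv u hu, ← hdiv v hv]
    exact Nat.div_le_div_right h
  have hKf : ∀ u v, K u ≤ K v → f v ≤ f u := by
    intro u v h
    induction hm : d u using Nat.strong_induction_on generalizing u v with
    | _ m ih =>
      by_cases hu : u = r
      · rw [hu]; exact hrmax v
      have hv : v ≠ r := by
        rintro rfl
        exact absurd h (not_le.2 (hKr_lt u hu))
      by_cases huv : ∃ k, p^[k] v = u
      · obtain ⟨k, rfl⟩ := huv
        exact hanc k v
      by_cases hvu : ∃ k, p^[k] u = v
      · obtain ⟨k, rfl⟩ := hvu
        exact (congrArg f (hKinj (le_antisymm h (hKanc k u)))).ge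
      by_cases hpp : p u = p v
      · rw [hK u hu, hK v hv, hpp] at h
        have := hσm (σ.symm u) (σ.symm v) (Fin.le_def.2 (by omega))
        simpa using this
      · have hdu := hp.depth u hu
        have hdv := hp.depth v hv
        have hle := ih _ (by omega) (p u) (p v) (hKmono u v hu hv h) rfl
        have hne : u ≠ v := by rintro rfl; exact hpp rfl
        have key := hT.connCount_lt_iff (hp.adj u hu).symm (hp.adj v hv).symm hne hpp ?_
        · exact not_lt.1 fun h' => absurd (key.2 h') (not_lt.2 hle)
        -- Neither of `u`, `v` is an ancestor of the other, so both parents still reach the root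
        -- once the two edges are cut.
        · have edges : ∀ z, z ≠ r → z ≠ u → z ≠ v →
              s(z, p z) ∉ ({s(p u, u), s(p v, v)} : Set (Sym2 (Fin n))) := by
            rintro z hz hzu hzv (h' | h')
            · rw [Sym2.eq_swap (a := p u)] at h'
              exact hzu (hp.eq_of_edge_eq hz hu h')
            · rw [Set.mem_singleton_iff, Sym2.eq_swap (a := p v)] at h'
              exact hzv (hp.eq_of_edge_eq hz hv h')
          have ru := hp.reachable_root (D := {s(p u, u), s(p v, v)}) (p u) fun k hk =>
            edges _ hk (fun h' => by
              have := hp.depth_iterate_le (p u) k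
              rw [h'] at this
              omega) (fun h' => hvu ⟨k + 1, h'⟩)
          have rv := hp.reachable_root (D := {s(p u, u), s(p v, v)}) (p v) fun k hk =>
            edges _ hk (fun h' => huv ⟨k + 1, h'⟩) (fun h' => by
              have := hp.depth_iterate_le (p v) k
              rw [h'] at this
              omega)
          exact ru.trans rv.symm
  set e := Tuple.sort K
  have heK : Monotone (K ∘ e) := Tuple.monotone_sort K
  have heK' : ∀ i j, K (e i) ≤ K (e j) ↔ i ≤ j := fun i j =>
    (heK.strictMono_of_injective (hKinj.comp e.injective)).le_iff_le
  obtain ⟨e₀, he₀⟩ := hT.2.1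
  have hdeg : ∀ i, (T.neighborSet (e i)).ncard = π i := by
    have h₀ : (fun v => (T.neighborSet v).ncard) ∘ e₀ = π := by
      funext i
      rw [← he₀ i, degree_eq_ncard]
      rfl
    -- Both `e` and `e₀` list the degrees in nonincreasing order, and such a list is unique.
    have h₁ := Tuple.unique_antitone (f := fun v => (T.neighborSet v).ncard) (σ := e) (τ := e₀)
      (fun i j hij => hT.ncard_neighborSet_le (hKf _ _ (heK hij))) (by rwa [h₀])
    rw [h₀] at h₁
    exact congrFun h₁
  refine iso_greedyTree hac hp e (fun v => ?_) (fun i j hi hj hij => ?_) hdeg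
  · rw [← heK', Equiv.apply_symm_apply]
    by_cases hv : e v = r
    · rw [hv]
    · exact (hKr_lt _ hv).le
  · rw [← heK', Equiv.apply_symm_apply, Equiv.apply_symm_apply]
    exact hKmono _ _ hi hj ((heK' i j).2 hij)

/-! ### Invariance under isomorphism and conclusion -/

theorem _root_.SimpleGraph.Iso.isConn_image {V W : Type*} {G : SimpleGraph V} {H : SimpleGraph W}
    (φ : G ≃g H) {S : Set V} (hS : IsConn G S) : IsConn H (φ '' S) := by
  refine ⟨hS.1.image _, ?_⟩
  rintro A ⟨_, ⟨a, ha, rfl⟩, haA⟩ hc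
  rw [Set.image_subset_iff]
  exact hS.2 (φ ⁻¹' A) ⟨a, ha, haA⟩ fun x hx hxA y hy hxy =>
    hc _ ⟨x, hx, rfl⟩ hxA _ ⟨y, hy, rfl⟩ (φ.map_adj_iff.2 hxy)

theorem connCount_empty_congr {V W : Type*} {G : SimpleGraph V} {H : SimpleGraph W}
    (φ : G ≃g H) : connCount G ∅ = connCount H ∅ := by
  refine Set.ncard_congr (fun S _ => φ '' S) ?_ ?_ ?_
  · exact fun S hS => ⟨φ.isConn_image hS.1, Set.empty_subset _⟩
  · exact fun S S' _ _ h => φ.injective.image_injective h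
  · intro S hS
    refine ⟨φ.symm '' S, ⟨φ.symm.isConn_image hS.1, Set.empty_subset _⟩, ?_⟩
    ext w
    simp

theorem HasDegreeSequence.of_iso {V W : Type*} [Fintype V] [Fintype W] {G : SimpleGraph V}
    {H : SimpleGraph W} (φ : G ≃g H) {n : ℕ} {π : Fin n → ℕ} (h : HasDegreeSequence G π) :
    HasDegreeSequence H π := by
  obtain ⟨e, he⟩ := h
  refine ⟨e.trans φ.toEquiv, fun i => ?_⟩
  rw [← he i, degree_eq_ncard, degree_eq_ncard, ← Set.ncard_image_of_injective _ φ.injective]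
  congr 1
  ext w
  obtain ⟨v, rfl⟩ := φ.surjective w
  simp [φ.map_adj_iff]

theorem exists_isOptimal {n : ℕ} {π : Fin n → ℕ}
    (hπ : ∃ T₀ : SimpleGraph (Fin n), T₀.IsTree ∧ HasDegreeSequence T₀ π) :
    ∃ T : SimpleGraph (Fin n), IsOptimal π T := by
  obtain ⟨T, hT, hmax⟩ := Set.exists_max_image
    {T : SimpleGraph (Fin n) | T.IsTree ∧ HasDegreeSequence T π} (fun T => connCount T ∅)
    (Set.toFinite _) hπ
  exact ⟨T, hT.1, hT.2, fun T' h₁ h₂ => hmax T' ⟨h₁, h₂⟩⟩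

theorem isOptimal_greedyTree {n : ℕ} {π : Fin n → ℕ} (hanti : Antitone π)
    (hπ : ∃ T₀ : SimpleGraph (Fin n), T₀.IsTree ∧ HasDegreeSequence T₀ π) :
    IsOptimal π (greedyTree π) := by
  obtain ⟨T, hT⟩ := exists_isOptimal hπ
  obtain ⟨φ⟩ := hT.nonempty_iso hanti
  exact ⟨φ.isTree_iff.1 hT.1, hT.2.1.of_iso φ, fun T' h₁ h₂ =>
    (hT.2.2 T' h₁ h₂).trans (connCount_empty_congr φ).le⟩

end GreedyTree

theorem theorem2p3 {n : ℕ} (π : Fin n → ℕ) (hanti : Antitone π)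
    (hπ : ∃ T₀ : SimpleGraph (Fin n), T₀.IsTree ∧ GreedyTree.HasDegreeSequence T₀ π) :
    (GreedyTree.greedyTree π).IsTree ∧
    GreedyTree.HasDegreeSequence (GreedyTree.greedyTree π) π ∧
    ∀ {V : Type*} [Fintype V] (T : SimpleGraph V),
      T.IsTree → GreedyTree.HasDegreeSequence T π →
        GreedyTree.numSubtrees T ≤ GreedyTree.numSubtrees (GreedyTree.greedyTree π) ∧
        (GreedyTree.numSubtrees T = GreedyTree.numSubtrees (GreedyTree.greedyTree π) ↔
          Nonempty (T ≃g GreedyTree.greedyTree π)) := by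
  have hopt := GreedyTree.isOptimal_greedyTree hanti hπ
  refine ⟨hopt.1, hopt.2.1, fun {V} _ T hT hdeg => ?_⟩
  rw [GreedyTree.numSubtrees_eq_connCount hT.isAcyclic,
    GreedyTree.numSubtrees_eq_connCount hopt.1.isAcyclic]
  obtain ⟨e, -⟩ := id hdeg
  have φ : T ≃g T.comap e := (SimpleGraph.Iso.comap e T).symm
  have htree := φ.isTree_iff.1 hT
  have hdeg' := hdeg.of_iso φ
  have hcount := GreedyTree.connCount_empty_congr φ
  refine ⟨hcount ▸ hopt.2.2 _ htree hdeg', fun heq => ?_,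
    fun ⟨ψ⟩ => GreedyTree.connCount_empty_congr ψ⟩
  -- Equal counts make the copy of `T` on `Fin n` optimal as well, so it too is the greedy tree.
  have hopt' : GreedyTree.IsOptimal π (T.comap e) :=
    ⟨htree, hdeg', fun T' h₁ h₂ => (hopt.2.2 T' h₁ h₂).trans (heq ▸ hcount).le⟩
  obtain ⟨ψ⟩ := hopt'.nonempty_iso hanti
  exact ⟨φ.trans ψ⟩
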